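/- Consider a tagged transmitter and a tagged receiver in the plane $\mathbb R^2$ at a fixed distance $r_0>0$, with path loss $l(r)=r^{-\beta}$, $\beta>0$. All users share a bandwidth $B$; each transmits with power $\bar Q>0$ (i.e. $\bar Q/B$ per Hz) and has target rate $\bar R>0$ bits/s (i.e. $\bar R/B$ per Hz); the noise power is $1$ per Hz. For each $B>0$ the interferers form a homogeneous Poisson point process $\Phi_B$ in the plane of density $\lambda_B=\kappa B^p$, with $\kappa>0$, where the processes live on one probability space and are nested: almost surely, $\Phi_B\subseteq\Phi_{B'}$ whenever $0<B\le B'$. The condition for decoding the tagged message while treating interference as noise (IAN) is $$\frac{\bar R}{B}\le C\Big(\frac{l(r_0)\,\bar Q/B}{1+I_B}\Big),\qquad I_B=\sum_{x\in\Phi_B} l(|x-y|)\,\frac{\bar Q}{B}\in[0,\infty],\qquad C(x)=\log_2(1+x),$$ where $y$ is the location of the receiver (if $I_B=\infty$, the argument of $C$ is $0$). If $p>2/\beta$, then for every target rate $\bar R>0$, almost surely there is a $B_0$ such that the IAN condition fails for all $B\ge B_0$. -/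

import Mathlib

open MeasureTheory ProbabilityTheory Filter
open scoped ENNReal NNReal

noncomputable section

namespace Wideband

/-- The Euclidean plane in which the nodes of the network live. -/
abbrev Plane : Type := EuclideanSpace ℝ (Fin 2)

/-- `Φ` is a homogeneous Poisson point process of density `lam` in the plane, viewed as a random
set of points: the number of points in a Borel set of finite area is Poisson distributed with mean
`lam` times the area, and the numbers of points in disjoint such sets are independent. (That `Φ` is
almost surely locally finite is a consequence.) -/
structure IsPoissonPointProcess {Ω : Type*} [MeasurableSpace Ω] (P : Measure Ω) (lam : ℝ)
    (Φ : Ω → Set Plane) : Prop where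
  hasLaw_count : ∀ A : Set Plane, MeasurableSet A → volume A ≠ ∞ →
    HasLaw (fun ω => (Φ ω ∩ A).encard)
      ((poissonMeasure (ENNReal.ofReal lam * volume A).toNNReal).map (Nat.cast : ℕ → ℕ∞)) P
  iIndepFun_count : ∀ A : ℕ → Set Plane, (∀ i, MeasurableSet (A i)) → (∀ i, volume (A i) ≠ ∞) →
    Pairwise (fun i j => Disjoint (A i) (A j)) →
    iIndepFun (fun i ω => (Φ ω ∩ A i).encard) P

/-- The path loss `l(r) = r ^ (-β)`, with `l(0) = ∞` when `β > 0` (the pole). -/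
def pathLoss (β : ℝ) (r : ℝ≥0∞) : ℝ≥0∞ := r ^ (-β)

/-- Power received at `y` from a transmitter at `x` that uses transmit power `Q`. -/
def receivedPower (β Q : ℝ) (x y : Plane) : ℝ≥0∞ :=
  pathLoss β (edist x y) * ENNReal.ofReal Q

/-- Total power received at `y` from interferers at the points of `S` (shot noise), each of them
using transmit power `Q`. -/
def interference (β Q : ℝ) (S : Set Plane) (y : Plane) : ℝ≥0∞ :=
  ∑' x : S, receivedPower β Q x y

/-- The Gaussian capacity function `C(x) = log₂ (1 + x)`, in bits/s/Hz. -/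
def capacity (x : ℝ) : ℝ := Real.logb 2 (1 + x)

/-- The condition `R ≤ C(P₀ / (1 + I))` for decoding at rate `R` while treating interference as
noise, the noise power being `1`. If `I = ∞`, the signal to interference and noise ratio is `0`. -/
def IANCondition (R : ℝ) (P₀ I : ℝ≥0∞) : Prop :=
  R ≤ capacity (P₀ / (1 + I)).toReal

/-- The condition for treating interference as noise at bandwidth `B`: all users have transmit power
`Qbar` (in Watts), i.e. `Qbar / B` per Hz, and target rate `Rbar` (in bits/s), i.e. `Rbar / B` per
Hz; the tagged transmitter is at `x₀`, the tagged receiver at `y`, the interferers at the points of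
`S`. -/
def IANConditionAtBandwidth (β Qbar Rbar : ℝ) (x₀ y : Plane) (S : Set Plane) (B : ℝ) : Prop :=
  IANCondition (Rbar / B) (receivedPower β (Qbar / B) x₀ y) (interference β (Qbar / B) S y)

end Wideband

end

/-! The nearest interferer alone defeats IAN. Fix `1/β < a < p/2`. A disc of radius `n^(-a)` about
the receiver is void with probability `exp(-κπ n^(p-2a))`, which is summable, so by Borel–Cantelli
it is eventually occupied along integers; nestedness carries the point from `⌊B⌋₊` to `B`. Its power
is at least of order `B^(aβ) * Qbar/B`. The factor `Qbar/B` cancels in the SINR, which is thus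
`O(B^(-aβ))`, while the required rate decays only like `1/B`. -/

open Asymptotics in
/-- A stretched exponential is summable over the natural numbers. -/
lemma Real.summable_exp_neg_mul_nat_rpow {b c : ℝ} (hb : 0 < b) (hc : 0 < c) :
    Summable fun n : ℕ => Real.exp (-b * (n : ℝ) ^ c) := by
  -- The exponent `-2 / c` becomes `-2` after substituting `n ^ c`.
  have h := (isLittleO_exp_neg_mul_rpow_atTop hb (-2 / c)).comp_tendsto
    ((tendsto_rpow_atTop hc).comp tendsto_natCast_atTop_atTop)
  refine summable_of_isBigO_nat (Real.summable_nat_rpow.2 (by norm_num : (-2 : ℝ) < -1))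
    (h.isBigO.congr_right fun n => ?_)
  simp only [Function.comp_apply]
  rw [← Real.rpow_mul (Nat.cast_nonneg n), mul_div_cancel₀ _ hc.ne']

namespace Wideband

/-- The void probability of a Poisson point process. -/
lemma IsPoissonPointProcess.measure_inter_eq_empty {Ω : Type*} [MeasurableSpace Ω]
    {P : Measure Ω} {lam : ℝ} {Φ : Ω → Set Plane} (h : IsPoissonPointProcess P lam Φ)
    {A : Set Plane} (hA : MeasurableSet A) (hA' : volume A ≠ ∞) :
    P {ω | Φ ω ∩ A = ∅} =
      ENNReal.ofReal (Real.exp (-((ENNReal.ofReal lam * volume A).toNNReal : ℝ))) := by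
  have := (h.hasLaw_count A hA hA').measure_eq (p := fun k => k = 0) (measurableSet_singleton 0)
  simp only [Set.encard_eq_zero] at this
  have h0 : (Nat.cast : ℕ → ℕ∞) ⁻¹' {0} = {0} := by ext; simp
  rw [this, Set.ofPred_eq_eq_singleton, Measure.map_apply (measurable_of_countable _)
    (measurableSet_singleton 0), h0, poissonMeasure_singleton]
  simp

/-- If the `n`-th process has density `κ * n ^ p`, then almost surely it eventually has a point
within distance `n ^ (-a)` of `y`, for every `a < p / 2`. -/
lemma ae_eventually_inter_ball_nonempty {Ω : Type*} [MeasurableSpace Ω] {P : Measure Ω}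
    {p κ a : ℝ} (hκ : 0 < κ) (ha : 2 * a < p) (y : Plane) {Φ : ℝ → Ω → Set Plane}
    (hΦ : ∀ B : ℝ, 0 < B → IsPoissonPointProcess P (κ * B ^ p) (Φ B)) :
    ∀ᵐ ω ∂P, ∀ᶠ n : ℕ in atTop, (Φ n ω ∩ Metric.ball y ((n : ℝ) ^ (-a))).Nonempty := by
  have key : ∀ n : ℕ, n ≠ 0 → P {ω | Φ n ω ∩ Metric.ball y ((n : ℝ) ^ (-a)) = ∅} =
      ENNReal.ofReal (Real.exp (-(κ * Real.pi) * (n : ℝ) ^ (p - 2 * a))) := by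
    intro n hn
    have hn' : (0 : ℝ) < n := by positivity
    rw [(hΦ n hn').measure_inter_eq_empty measurableSet_ball measure_ball_lt_top.ne]
    congr 2
    rw [EuclideanSpace.volume_ball_fin_two]
    simp only [ENNReal.coe_toNNReal_eq_toReal, ENNReal.toReal_mul, ENNReal.toReal_pow]
    rw [ENNReal.toReal_ofReal (by positivity), ENNReal.toReal_ofReal (by positivity),
      sub_eq_add_neg, Real.rpow_add hn', ← Real.rpow_mul_natCast hn'.le]
    rw [ENNReal.toReal_ofReal Real.pi_nonneg]
    push_cast
    rw [show -a * 2 = -(2 * a) by ring]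
    ring
  -- The void probability is known only for positive bandwidth, hence `n ≠ 0`.
  have hsum : ∑' n : ℕ, P {ω | n ≠ 0 ∧ Φ n ω ∩ Metric.ball y ((n : ℝ) ^ (-a)) = ∅} ≠ ∞ := by
    refine ne_top_of_le_ne_top (Real.summable_exp_neg_mul_nat_rpow (b := κ * Real.pi)
      (c := p - 2 * a) (by positivity) (by linarith)).tsum_ofReal_ne_top
      (ENNReal.tsum_le_tsum fun n => ?_)
    by_cases hn : n = 0
    · simp [hn]
    · simp [hn, key n hn]
  filter_upwards [ae_eventually_notMem hsum] with ω hω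
  filter_upwards [hω, eventually_ne_atTop 0] with n hn hn0
  by_contra h
  exact hn ⟨hn0, Set.not_nonempty_iff_eq_empty.1 h⟩

/-- The interference is at least the power received from any one interferer. -/
lemma le_interference {β Q r : ℝ} (hβ : 0 ≤ β) (hr : 0 < r) {S : Set Plane} {x y : Plane}
    (hx : x ∈ S) (hxy : dist x y ≤ r) :
    ENNReal.ofReal (r ^ (-β) * Q) ≤ interference β Q S y := by
  refine le_trans ?_ (ENNReal.le_tsum (⟨x, hx⟩ : S))
  rw [ENNReal.ofReal_mul (by positivity), ← ENNReal.ofReal_rpow_of_pos hr]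
  unfold receivedPower pathLoss
  gcongr ?_ * _
  rw [ENNReal.rpow_neg, ENNReal.rpow_neg, ENNReal.inv_le_inv, edist_dist]
  gcongr

lemma receivedPower_of_ne (β Q : ℝ) {x y : Plane} (hxy : x ≠ y) :
    receivedPower β Q x y = ENNReal.ofReal (dist x y ^ (-β) * Q) := by
  rw [receivedPower, pathLoss, edist_dist, ENNReal.ofReal_rpow_of_pos (dist_pos.2 hxy),
    ENNReal.ofReal_mul (by positivity)]

lemma capacity_le {x : ℝ} (hx : 0 ≤ x) : capacity x ≤ x / Real.log 2 := by
  refine div_le_div_of_nonneg_right ?_ (Real.log_nonneg one_le_two)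
  linarith [Real.log_le_sub_one_of_pos (by linarith : 0 < 1 + x)]

/-- Treating interference as noise fails once the interference is large compared with the ratio
of signal power to rate. -/
lemma not_IANCondition {R s M : ℝ} {I : ℝ≥0∞} (hM : 0 < M) (hI : ENNReal.ofReal M ≤ I)
    (hs : 0 ≤ s) (h : s / M < R * Real.log 2) : ¬ IANCondition R (ENNReal.ofReal s) I := by
  intro hc
  have h1 : (ENNReal.ofReal s / (1 + I)).toReal ≤ s / M := by
    refine ENNReal.toReal_le_of_le_ofReal (by positivity) ?_
    rw [ENNReal.ofReal_div_of_pos hM]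
    gcongr
    exact hI.trans le_add_self
  have h2 := hc.trans (capacity_le ENNReal.toReal_nonneg)
  rw [le_div_iff₀ (Real.log_pos one_lt_two)] at h2
  linarith

end Wideband

theorem theorem4 {Ω : Type*} [MeasurableSpace Ω] (P : Measure Ω) [IsProbabilityMeasure P]
    (β p κ Qbar : ℝ) (hβ : 0 < β) (hp : 2 / β < p) (hκ : 0 < κ) (hQ : 0 < Qbar)
    (x₀ y : Wideband.Plane) (hxy : x₀ ≠ y)
    (Φ : ℝ → Ω → Set Wideband.Plane)
    (hΦ : ∀ B : ℝ, 0 < B → Wideband.IsPoissonPointProcess P (κ * B ^ p) (Φ B))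
    (hmono : ∀ᵐ ω ∂P, ∀ B B' : ℝ, 0 < B → B ≤ B' → Φ B ω ⊆ Φ B' ω)
    (Rbar : ℝ) (hR : 0 < Rbar) :
    ∀ᵐ ω ∂P, ∀ᶠ B : ℝ in atTop,
      ¬ Wideband.IANConditionAtBandwidth β Qbar Rbar x₀ y (Φ B ω) B := by
  -- `a < p / 2` makes the discs eventually occupied; `a > 1 / β` makes the interference beat the
  -- decay of the rate.
  obtain ⟨a, ha₁, ha₂⟩ := exists_between (show 1 / β < p / 2 by
    rw [show 1 / β = 2 / β / 2 by ring]; linarith)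
  have haβ : 0 < a * β - 1 := by rw [div_lt_iff₀ hβ] at ha₁; linarith
  have hd : 0 < dist x₀ y := dist_pos.2 hxy
  have hlog : 0 < Real.log 2 := Real.log_pos one_lt_two
  have hlim := ((tendsto_rpow_atTop haβ).comp
    (tendsto_natCast_atTop_atTop (R := ℝ))).comp (tendsto_nat_floor_atTop (α := ℝ))
  filter_upwards [hmono, Wideband.ae_eventually_inter_ball_nonempty hκ (a := a) (by linarith) y hΦ]
    with ω hm hω
  -- The factor `2` in the threshold pays for `B ≤ 2 * ⌊B⌋₊`.
  filter_upwards [tendsto_nat_floor_atTop.eventually hω, eventually_ge_atTop 1,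
    hlim.eventually_gt_atTop (2 * dist x₀ y ^ (-β) / (Rbar * Real.log 2))] with B hB hB1 hlarge
  obtain ⟨x, hxΦ, hx⟩ := hB
  simp only [Function.comp_apply] at hlarge
  have hn1 : (1 : ℝ) ≤ ⌊B⌋₊ := by exact_mod_cast (Nat.one_le_floor_iff B).2 hB1
  have hB2 : B ≤ 2 * ⌊B⌋₊ := by linarith [Nat.lt_floor_add_one B]
  have hxB := hm _ B (by linarith) (Nat.floor_le (by linarith)) hxΦ
  generalize (⌊B⌋₊ : ℝ) = t at *
  have ht : 0 < t := by linarith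
  have hB0 : 0 < B := by linarith
  unfold Wideband.IANConditionAtBandwidth
  rw [Wideband.receivedPower_of_ne _ _ hxy]
  refine Wideband.not_IANCondition (M := (t ^ (-a)) ^ (-β) * (Qbar / B)) (by positivity)
    (Wideband.le_interference hβ.le (by positivity) hxB (Metric.mem_ball.1 hx).le)
    (by positivity) ?_
  have hpow : (t ^ (-a)) ^ (-β) = t ^ (a * β - 1) * t := by
    rw [← Real.rpow_mul ht.le, ← Real.rpow_add_one ht.ne']
    ring_nf
  -- Signal and interference share the factor `Qbar / B`, which cancels.
  rw [mul_div_mul_right _ _ (by positivity), hpow, div_mul_eq_mul_div,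
    div_lt_div_iff₀ (by positivity) hB0]
  rw [div_lt_iff₀ (by positivity)] at hlarge
  calc dist x₀ y ^ (-β) * B ≤ dist x₀ y ^ (-β) * (2 * t) := by gcongr
    _ = 2 * dist x₀ y ^ (-β) * t := by ring
    _ < t ^ (a * β - 1) * (Rbar * Real.log 2) * t := by gcongr
    _ = Rbar * Real.log 2 * (t ^ (a * β - 1) * t) := by ring
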